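/- Let $H^\infty$ be the algebra of bounded holomorphic functions on the open unit disc $\mathbb D$, and for $\lambda\in\mathbb D$ put $b_\lambda(z)=\frac{z-\lambda}{1-\overline{\lambda}z}$. For a completely non-unitary contraction $T$ on a complex Hilbert space $\mathcal H$ and $u\in H^\infty$, let $u(T)$ be given by the Sz.-Nagy–Foias functional calculus, that is, $u(T)$ is the strong limit of $\sum_n \hat u(n)r^nT^n$ as $r\to1^-$, where $u(z)=\sum_n\hat u(n)z^n$; let $H^\infty(T)=\{u(T):u\in H^\infty\}$, with the operator norm. Such a $T$ is of class $C_0$ if $u(T)=0$ for some $u\neq0$; an inner function $\theta$ is a minimal function of $T$ if $\{u\in H^\infty:u(T)=0\}=\theta H^\infty$; and $T$ is multiplicity-free if it has a cyclic vector. For $\theta$ inner, let $H(\theta)=H^2\ominus\theta H^2$ and let $S(\theta)$ be the operator on $H(\theta)$ with $S(\theta)^*=S^*|H(\theta)$, where $S$ is multiplication by $z$ on the Hardy space $H^2$. There is a function $C:\mathbb R\to(0,\infty)$ with the following property. Let $T$ be a multiplicity-free operator of class $C_0$ on a Hilbert space $\mathcal H$ with minimal function $\theta=b_{\lambda_1}b_{\lambda_2}$,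 where $\lambda_1,\lambda_2\in\mathbb D$ are arbitrary (possibly equal), and suppose that $\Psi:H^\infty(T)\to H^\infty(S(\theta))$ is a bounded linear map such that $\Psi(u(T))=u(S(\theta))$ for every $u\in H^\infty$. Then there is a bounded invertible operator $X:\mathcal H\to H(\theta)$ with bounded inverse such that $XT=S(\theta)X$ and $$\max\{\|X\|,\|X^{-1}\|\}\le C(\|\Psi\|).$$ -/

import Mathlib

open Filter Topology MeasureTheory
open scoped BoundedContinuousFunction Complex.UnitDisc ComplexConjugate InnerProductSpace ENNReal

noncomputable section

namespace C0Similarity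

/-! ### The algebra of bounded holomorphic functions on the unit disc -/

/-- Extension of a function on the unit disc to the plane, by zero. -/
def extZero (u : 𝔻 → ℂ) : ℂ → ℂ := Function.extend Complex.UnitDisc.coe u 0

theorem extZero_coe (u : 𝔻 → ℂ) (z : 𝔻) : extZero u (z : ℂ) = u z :=
  Complex.UnitDisc.coe_injective.extend_apply _ _ _

theorem extZero_of_lt (u : 𝔻 → ℂ) {z : ℂ} (hz : ‖z‖ < 1) : extZero u z = u (Complex.UnitDisc.mk z hz) :=
  extZero_coe u (Complex.UnitDisc.mk z hz)

/-- `H^∞` as a subalgebra of the bounded continuous functions on the open unit disc: those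
functions that are holomorphic. -/
def hInfSubalgebra : Subalgebra ℂ (𝔻 →ᵇ ℂ) where
  carrier := {u | DifferentiableOn ℂ (extZero u) (Metric.ball 0 1)}
  mul_mem' {u v} hu hv := by
    refine (DifferentiableOn.mul hu hv).congr fun z hz => ?_
    rw [mem_ball_zero_iff] at hz
    simp [extZero_of_lt _ hz]
  add_mem' {u v} hu hv := by
    refine (DifferentiableOn.add hu hv).congr fun z hz => ?_
    rw [mem_ball_zero_iff] at hz
    simp [extZero_of_lt _ hz]
  algebraMap_mem' c := by
    refine (differentiableOn_const c).congr fun z hz => ?_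
    rw [mem_ball_zero_iff] at hz
    rw [extZero_of_lt _ hz]
    simp [BoundedContinuousFunction.algebraMap_apply]

/-- The algebra `H^∞` of bounded holomorphic functions on the open unit disc, with pointwise
operations. -/
abbrev HInf : Type := hInfSubalgebra

/-- The value of `u ∈ H^∞` at a point of the disc. -/
def HInf.eval (u : HInf) (z : 𝔻) : ℂ := u.1 z

/-- The Taylor coefficients at the origin: `u(z) = ∑ uₙ zⁿ`. -/
def HInf.coeff (u : HInf) (n : ℕ) : ℂ :=
  (n.factorial : ℂ)⁻¹ * iteratedDeriv n (extZero u.1) 0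

theorem HInf.hasSum (u : HInf) (z : 𝔻) :
    HasSum (fun n => u.coeff n * (z : ℂ) ^ n) (u.eval z) := by
  have h := Complex.hasSum_taylorSeries_on_ball (c := 0) (r := 1) (z := (z : ℂ))
    (f := extZero u.1) u.2 (by simpa using z.norm_lt_one)
  rw [extZero_coe] at h
  refine h.congr_fun fun n => ?_
  simp [HInf.coeff]; ring

theorem HInf.contDiffAt (u : HInf) (n : ℕ) : ContDiffAt ℂ n (extZero u.1) 0 :=
  (u.2.analyticAt (Metric.ball_mem_nhds 0 one_pos)).contDiffAt

theorem HInf.extZero_mul (u v : HInf) : extZero (u * v).1 = extZero u.1 * extZero v.1 := by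
  funext z
  by_cases hz : ‖z‖ < 1
  · simp [extZero_of_lt _ hz]
  · have h : ¬ ∃ w : 𝔻, (w : ℂ) = z := fun ⟨w, hw⟩ => hz (hw ▸ w.norm_lt_one)
    simp [extZero, Function.extend_apply' _ _ _ h]

theorem HInf.extZero_add (u v : HInf) : extZero (u + v).1 = extZero u.1 + extZero v.1 := by
  funext z
  by_cases hz : ‖z‖ < 1
  · simp [extZero_of_lt _ hz]
  · have h : ¬ ∃ w : 𝔻, (w : ℂ) = z := fun ⟨w, hw⟩ => hz (hw ▸ w.norm_lt_one)
    simp [extZero, Function.extend_apply' _ _ _ h]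

theorem HInf.coeff_add (u v : HInf) (n : ℕ) : (u + v).coeff n = u.coeff n + v.coeff n := by
  simp only [HInf.coeff, HInf.extZero_add]
  rw [iteratedDeriv_add (u.contDiffAt n) (v.contDiffAt n), mul_add]

theorem HInf.coeff_mul (u v : HInf) (n : ℕ) :
    (u * v).coeff n = ∑ p ∈ Finset.HasAntidiagonal.antidiagonal n, u.coeff p.1 * v.coeff p.2 := by
  simp only [HInf.coeff, HInf.extZero_mul]
  rw [iteratedDeriv_mul (u.contDiffAt n) (v.contDiffAt n),
    Finset.Nat.sum_antidiagonal_eq_sum_range_succ_mk, Finset.mul_sum]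
  refine Finset.sum_congr rfl fun i hi => ?_
  have hi' : i ≤ n := Nat.lt_succ_iff.mp (Finset.mem_range.mp hi)
  rw [Nat.cast_choose ℂ hi']
  have := Nat.cast_ne_zero (R := ℂ).mpr n.factorial_ne_zero
  have := Nat.cast_ne_zero (R := ℂ).mpr i.factorial_ne_zero
  have := Nat.cast_ne_zero (R := ℂ).mpr (n - i).factorial_ne_zero
  field_simp

theorem HInf.coeff_algebraMap (c : ℂ) (n : ℕ) :
    (algebraMap ℂ HInf c).coeff n = if n = 0 then c else 0 := by
  have h : extZero (algebraMap ℂ HInf c).1 =ᶠ[𝓝 0] fun _ => c := by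
    filter_upwards [Metric.ball_mem_nhds (0 : ℂ) one_pos] with z hz
    rw [mem_ball_zero_iff] at hz
    rw [extZero_of_lt _ hz]
    simp [BoundedContinuousFunction.algebraMap_apply]
  simp only [HInf.coeff, h.iteratedDeriv_eq, iteratedDeriv_const]
  split_ifs with hn <;> simp [hn]

theorem one_sub_le_norm (l z : 𝔻) : 1 - ‖(l : ℂ)‖ ≤ ‖1 - conj (l : ℂ) * z‖ := by
  have h1 : ‖conj (l : ℂ) * z‖ ≤ ‖(l : ℂ)‖ := by
    rw [norm_mul, RCLike.norm_conj]
    exact mul_le_of_le_one_right (norm_nonneg _) z.norm_lt_one.le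
  have h2 := norm_sub_norm_le (1 : ℂ) (conj (l : ℂ) * z)
  rw [norm_one] at h2
  linarith

theorem one_sub_ne_zero (l z : 𝔻) : 1 - conj (l : ℂ) * z ≠ 0 := by
  have h1 := one_sub_le_norm l z
  have h2 := l.norm_lt_one
  exact norm_pos_iff.mp (by linarith)

/-- The Blaschke factor `b_λ(z) = (z - λ) / (1 - \bar λ z)`. -/
def blaschke (l : 𝔻) : HInf :=
  ⟨BoundedContinuousFunction.ofNormedAddCommGroup
      (fun z : 𝔻 => ((z : ℂ) - l) / (1 - conj (l : ℂ) * z))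
      (by
        refine Continuous.div (by fun_prop) (by fun_prop) fun z => one_sub_ne_zero l z)
      (2 / (1 - ‖(l : ℂ)‖))
      (by
        intro z
        have h1 := one_sub_le_norm l z
        have h2 := l.norm_lt_one
        have h3 := z.norm_lt_one
        have h4 := norm_sub_le (z : ℂ) l
        rw [norm_div]
        exact div_le_div₀ (by norm_num) (by linarith) (by linarith) h1),
    by
      have h : DifferentiableOn ℂ (fun z : ℂ => (z - l) / (1 - conj (l : ℂ) * z))
          (Metric.ball 0 1) := by
        refine DifferentiableOn.div (by fun_prop) (by fun_prop) fun z hz => ?_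
        exact one_sub_ne_zero l (Complex.UnitDisc.mk z (by simpa using hz))
      refine h.congr fun z hz => ?_
      rw [mem_ball_zero_iff] at hz
      simp [extZero_of_lt _ hz]⟩

theorem blaschke_eval (l z : 𝔻) :
    (blaschke l).eval z = ((z : ℂ) - l) / (1 - conj (l : ℂ) * z) := rfl

/-- A function in `H^∞` is inner if its radial limits have modulus one almost everywhere. -/
def IsInner (θ : HInf) : Prop :=
  ∀ᵐ t : ℝ, Tendsto (fun r : ℝ => ‖extZero θ.1 (r * Complex.exp (t * Complex.I))‖) (𝓝[<] 1) (𝓝 1)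

/-! ### The functional calculus and operators of class `C₀` -/

section Operators

variable {H : Type*} [NormedAddCommGroup H] [InnerProductSpace ℂ H] [CompleteSpace H]

/-- The operator `u_r(T) = ∑ uₙ rⁿ Tⁿ`, where `u_r(z) = u(rz)`. For `‖T‖ ≤ 1` and `0 ≤ r < 1` the
series converges absolutely. -/
def dilate (T : H →L[ℂ] H) (u : HInf) (r : ℝ) : H →L[ℂ] H :=
  ∑' n : ℕ, (u.coeff n * (r : ℂ) ^ n) • T ^ n

/-- `HasValue T u A` says `u(T) = A` in the Sz.-Nagy--Foias functional calculus:
`A` is the strong limit of `u_r(T)` as `r` increases to `1`. (For a completely non-unitary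
contraction `T` this limit exists for each `u ∈ H^∞`.) -/
def HasValue (T : H →L[ℂ] H) (u : HInf) (A : H →L[ℂ] H) : Prop :=
  ∀ x : H, Tendsto (fun r : ℝ => dilate T u r x) (𝓝[<] 1) (𝓝 (A x))

theorem summable_dilate {T : H →L[ℂ] H} (hT : ‖T‖ ≤ 1) (u : HInf) {r : ℝ} (h0 : 0 ≤ r)
    (h1 : r < 1) : Summable fun n => ‖(u.coeff n * (r : ℂ) ^ n) • T ^ n‖ := by
  have hr : ‖(r : ℂ)‖ < 1 := by simpa [abs_of_nonneg h0] using h1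
  refine Summable.of_nonneg_of_le (fun _ => norm_nonneg _) (fun n => ?_)
    (u.hasSum (Complex.UnitDisc.mk r hr)).summable.norm
  rw [norm_smul, Complex.UnitDisc.coe_mk]
  refine mul_le_of_le_one_right (norm_nonneg _) ?_
  rcases subsingleton_or_nontrivial H with h | h
  · rw [Subsingleton.elim (T ^ n) 0, norm_zero]; exact zero_le_one
  · exact (norm_pow_le T n).trans (pow_le_one₀ (norm_nonneg _) hT)

theorem eventually_Ico : ∀ᶠ r : ℝ in 𝓝[<] 1, 0 ≤ r ∧ r < 1 := by
  filter_upwards [Ico_mem_nhdsLT (zero_lt_one (α := ℝ))] with r hr using hr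

theorem dilate_add {T : H →L[ℂ] H} (hT : ‖T‖ ≤ 1) (u v : HInf) {r : ℝ} (h0 : 0 ≤ r)
    (h1 : r < 1) : dilate T (u + v) r = dilate T u r + dilate T v r := by
  rw [dilate, dilate, dilate, ← (summable_dilate hT u h0 h1).of_norm.tsum_add
    (summable_dilate hT v h0 h1).of_norm]
  simp [HInf.coeff_add, add_mul, add_smul]

theorem dilate_mul {T : H →L[ℂ] H} (hT : ‖T‖ ≤ 1) (u v : HInf) {r : ℝ} (h0 : 0 ≤ r)
    (h1 : r < 1) : dilate T (u * v) r = dilate T u r * dilate T v r := by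
  rw [dilate, dilate, dilate, tsum_mul_tsum_eq_tsum_sum_antidiagonal_of_summable_norm
    (summable_dilate hT u h0 h1) (summable_dilate hT v h0 h1)]
  refine tsum_congr fun n => ?_
  rw [HInf.coeff_mul, Finset.sum_mul, Finset.sum_smul]
  refine Finset.sum_congr rfl fun p hp => ?_
  rw [smul_mul_smul_comm, ← pow_add, Finset.HasAntidiagonal.mem_antidiagonal.mp hp]
  congr 1
  rw [← Finset.HasAntidiagonal.mem_antidiagonal.mp hp, pow_add]; ring

set_option linter.unusedSectionVars false in
theorem dilate_algebraMap (T : H →L[ℂ] H) (c : ℂ) (r : ℝ) :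
    dilate T (algebraMap ℂ HInf c) r = algebraMap ℂ (H →L[ℂ] H) c := by
  rw [dilate, tsum_eq_single 0 fun n hn => by simp [HInf.coeff_algebraMap, hn]]
  rw [HInf.coeff_algebraMap, Algebra.algebraMap_eq_smul_one]
  simp

theorem HasValue.add {T : H →L[ℂ] H} (hT : ‖T‖ ≤ 1) {u v : HInf} {A B : H →L[ℂ] H}
    (hu : HasValue T u A) (hv : HasValue T v B) : HasValue T (u + v) (A + B) := by
  intro x
  refine ((hu x).add (hv x)).congr' ?_
  filter_upwards [eventually_Ico] with r hr
  simp [dilate_add hT u v hr.1 hr.2]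

theorem HasValue.mul {T : H →L[ℂ] H} (hT : ‖T‖ ≤ 1) {u v : HInf} {A B : H →L[ℂ] H}
    (hu : HasValue T u A) (hv : HasValue T v B) : HasValue T (u * v) (A * B) := by
  intro x
  rw [tendsto_iff_seq_tendsto]
  intro s hs
  have hus : ∀ y, Tendsto (fun n => dilate T u (s n) y) atTop (𝓝 (A y)) :=
    fun y => (hu y).comp hs
  obtain ⟨K, hK⟩ : ∃ K, ∀ n, ‖dilate T u (s n)‖ ≤ K := by
    refine banach_steinhaus fun y => ?_
    obtain ⟨K, hK⟩ := (hus y).norm.bddAbove_range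
    exact ⟨K, fun n => hK ⟨n, rfl⟩⟩
  have h1 : Tendsto (fun n => dilate T u (s n) (dilate T v (s n) x - B x)) atTop (𝓝 0) := by
    refine squeeze_zero_norm (fun n => (dilate T u (s n)).le_of_opNorm_le (hK n) _) ?_
    have := (((hv x).comp hs).sub_const (B x)).norm.const_mul K
    simpa using this
  have h2 := h1.add (hus (B x))
  rw [zero_add] at h2
  refine h2.congr' ?_
  filter_upwards [hs.eventually eventually_Ico] with n hn
  simp [dilate_mul hT u v hn.1 hn.2]

/-- The algebra `H^∞(T) = {u(T) : u ∈ H^∞}`, with the operator norm. -/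
def HInfOf (T : H →L[ℂ] H) (hT : ‖T‖ ≤ 1) : Subalgebra ℂ (H →L[ℂ] H) where
  carrier := {A | ∃ u : HInf, HasValue T u A}
  mul_mem' := by
    rintro A B ⟨u, hu⟩ ⟨v, hv⟩
    exact ⟨u * v, hu.mul hT hv⟩
  add_mem' := by
    rintro A B ⟨u, hu⟩ ⟨v, hv⟩
    exact ⟨u + v, hu.add hT hv⟩
  algebraMap_mem' c := ⟨algebraMap ℂ HInf c, fun x => by
    simp only [dilate_algebraMap]; exact tendsto_const_nhds⟩

/-- `T` is completely non-unitary: no nonzero closed subspace reduces `T` to a unitary operator. -/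
def CompletelyNonUnitary (T : H →L[ℂ] H) : Prop :=
  ∀ M : Submodule ℂ H, IsClosed (M : Set H) →
    (∀ x ∈ M, T x ∈ M ∧ T.adjoint x ∈ M) →
    (∀ x ∈ M, T.adjoint (T x) = x ∧ T (T.adjoint x) = x) → M = ⊥

/-- `T` is of class `C₀`: a completely non-unitary contraction for which the functional calculus
`u ↦ u(T)` on `H^∞` has a nontrivial kernel. -/
structure IsClassC0 (T : H →L[ℂ] H) : Prop where
  contraction : ‖T‖ ≤ 1
  completelyNonUnitary : CompletelyNonUnitary T
  exists_ne_zero : ∃ u : HInf, u ≠ 0 ∧ HasValue T u 0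

/-- `θ` is a minimal function of `T`: it is inner, and the kernel of the functional calculus
of `T` is `θ H^∞`. -/
def IsMinimalFunction (T : H →L[ℂ] H) (θ : HInf) : Prop :=
  IsInner θ ∧ ∀ u : HInf, HasValue T u 0 ↔ ∃ f : HInf, u = θ * f

/-- `T` is multiplicity-free: it has a cyclic vector. -/
def MultiplicityFree (T : H →L[ℂ] H) : Prop :=
  ∃ x : H, (Submodule.span ℂ (Set.range fun n : ℕ => (T ^ n) x)).topologicalClosure = ⊤

end Operators

/-! ### The Hardy space `H²` and Jordan blocks -/

/-- The Hardy space `H²`. The function `f(z) = ∑ aₙ zⁿ` with `∑ |aₙ|² < ∞` is represented by its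
sequence of Taylor coefficients, with `‖f‖² = ∑ |aₙ|²`. -/
abbrev HTwo : Type := lp (fun _ : ℕ => ℂ) 2

/-- The value `f(z) = ∑ aₙ zⁿ` of `f ∈ H²` at a point of the disc. -/
def HTwo.eval (f : HTwo) (z : 𝔻) : ℂ := ∑' n : ℕ, f n * (z : ℂ) ^ n

theorem HTwo.summable (f : HTwo) (z : 𝔻) : Summable fun n : ℕ => f n * (z : ℂ) ^ n := by
  refine Summable.of_norm_bounded
    (g := fun n => ‖f‖ * ‖(z : ℂ)‖ ^ n)
    ((summable_geometric_of_lt_one (norm_nonneg _) z.norm_lt_one).mul_left _) fun n => ?_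
  rw [norm_mul, norm_pow]
  gcongr
  exact lp.norm_apply_le_norm (by norm_num) f n

theorem HTwo.eval_add (f g : HTwo) (z : 𝔻) : (f + g).eval z = f.eval z + g.eval z := by
  simp only [HTwo.eval]
  rw [← (f.summable z).tsum_add (g.summable z)]
  simp [add_mul]

theorem HTwo.eval_smul (c : ℂ) (f : HTwo) (z : 𝔻) : (c • f).eval z = c * f.eval z := by
  simp only [HTwo.eval]
  rw [← tsum_mul_left]
  simp [mul_assoc]

/-- The sequence `(0, a₀, a₁, …)`. -/
def shiftFun (a : ℕ → ℂ) : ℕ → ℂ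
  | 0 => 0
  | n + 1 => a n

theorem shiftFun_hasSum (f : HTwo) :
    HasSum (fun n => ‖shiftFun f n‖ ^ (2 : ℝ≥0∞).toReal) (‖f‖ ^ (2 : ℝ≥0∞).toReal) := by
  rw [← hasSum_nat_add_iff' 1]
  simpa [shiftFun] using lp.hasSum_norm (by norm_num) f

/-- The unilateral shift `S` on `H²`, that is, multiplication by `z`. -/
def shift : HTwo →ₗᵢ[ℂ] HTwo where
  toFun f := ⟨shiftFun f, memℓp_gen (shiftFun_hasSum f).summable⟩
  map_add' f g := by
    ext n
    change shiftFun (f + g : HTwo) n = shiftFun f n + shiftFun g n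
    cases n <;> simp [shiftFun]
  map_smul' c f := by
    ext n
    cases n <;> simp [shiftFun]
  norm_map' f := by
    have h := (lp.hasSum_norm (p := 2) (by norm_num)
      (⟨shiftFun f, memℓp_gen (shiftFun_hasSum f).summable⟩ : HTwo)).unique (shiftFun_hasSum f)
    exact (Real.rpow_left_inj (norm_nonneg _) (norm_nonneg _) (by norm_num)).mp h

theorem eval_shift (f : HTwo) (z : 𝔻) : (shift f).eval z = z * f.eval z := by
  have h : ∀ n, (shift f) n = shiftFun f n := fun _ => rfl
  simp only [HTwo.eval]
  rw [((shift f).summable z).tsum_eq_zero_add, ← tsum_mul_left]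
  simp only [h, shiftFun, zero_mul, zero_add]
  exact tsum_congr fun n => by ring

/-- The subspace `θ H²` of `H²`. -/
def mulRange (θ : HInf) : Submodule ℂ HTwo where
  carrier := {f | ∃ g : HTwo, ∀ z : 𝔻, f.eval z = θ.eval z * g.eval z}
  zero_mem' := ⟨0, fun z => by simp [HTwo.eval]⟩
  add_mem' := by
    rintro f₁ f₂ ⟨g₁, h₁⟩ ⟨g₂, h₂⟩
    exact ⟨g₁ + g₂, fun z => by rw [HTwo.eval_add, HTwo.eval_add, h₁, h₂, mul_add]⟩
  smul_mem' := by
    rintro c f ⟨g, h⟩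
    exact ⟨c • g, fun z => by rw [HTwo.eval_smul, HTwo.eval_smul, h]; ring⟩

/-- The model space `H(θ) = H² ⊖ θ H²`. -/
abbrev HTheta (θ : HInf) : Submodule ℂ HTwo := (mulRange θ)ᗮ

theorem adjoint_shift_mem (θ : HInf) :
    ∀ f ∈ HTheta θ, shift.toContinuousLinearMap.adjoint f ∈ HTheta θ := by
  intro f hf
  rw [Submodule.mem_orthogonal] at hf ⊢
  rintro k ⟨g, hg⟩
  rw [ContinuousLinearMap.adjoint_inner_right]
  exact hf _ ⟨shift g, fun z => by
    change (shift k).eval z = _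
    rw [eval_shift, eval_shift, hg]; ring⟩

/-- The Jordan block `S(θ)` on `H(θ)`, defined by `S(θ)* = S* | H(θ)`. -/
def jordanBlock (θ : HInf) : HTheta θ →L[ℂ] HTheta θ :=
  (shift.toContinuousLinearMap.adjoint.restrict (adjoint_shift_mem θ)).adjoint

theorem norm_jordanBlock_le (θ : HInf) : ‖jordanBlock θ‖ ≤ 1 := by
  rw [jordanBlock, LinearIsometryEquiv.norm_map]
  refine ContinuousLinearMap.opNorm_le_bound _ zero_le_one fun x => ?_
  have h : ‖shift.toContinuousLinearMap.adjoint‖ ≤ 1 := by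
    rw [LinearIsometryEquiv.norm_map]
    exact shift.norm_toContinuousLinearMap_le
  exact shift.toContinuousLinearMap.adjoint.le_of_opNorm_le h _

end C0Similarity

end

open C0Similarity

/-! Both `T` and `S(θ)` live on two-dimensional spaces, and in suitable orthonormal bases both are
upper triangular with the same ordered diagonal `l₁, l₂`; only the corners `a` and `s` differ.
Contractivity gives `|a|² ≤ (1 - |l₁|²)(1 - |l₂|²)` (`IsTriangular.corner_le`), while `s` attains at
least this bound because `S(θ)*` preserves the norm of a nonzero vector (`IsTriangular.le_corner`,
`exists_isTriangular_jordanBlock`). Hence `|a| ≤ |s|` and `s ≠ 0`.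

The map `Ψ` enters through the single function `z - l₂`: with `K = ‖Ψ‖`, comparing `S(θ) - l₂` with
`T - l₂` yields `|s| ≤ K(|l₁ - l₂| + |a|)`. So either `a` is comparable to `s`, and a diagonal
matrix is a good similarity, or `|l₁ - l₂|` is, and a unipotent matrix is (`exists_similarity`).
Both cases are covered by `2 + 4K`. -/

noncomputable section

namespace C0Similarity

/-! ### Operators on a two-dimensional space -/

section TwoDimensional

variable {V : Type*} [NormedAddCommGroup V] [InnerProductSpace ℂ V]

/-- `T` is upper triangular with diagonal `l₁, l₂` and corner `a` in the orthonormal basis `e`. -/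
def IsTriangular (T : V →L[ℂ] V) (e : OrthonormalBasis (Fin 2) ℂ V) (l₁ l₂ a : ℂ) : Prop :=
  T (e 0) = l₁ • e 0 ∧ T (e 1) = a • e 0 + l₂ • e 1

theorem exists_isTriangular (hV : Module.finrank ℂ V = 2) (T : V →L[ℂ] V) (l₁ l₂ : ℂ)
    (hann : ∀ x, T (T x) - (l₁ + l₂) • T x + (l₁ * l₂) • x = 0)
    (hns : ∀ μ : ℂ, ∃ x, T x ≠ μ • x) :
    ∃ (e : OrthonormalBasis (Fin 2) ℂ V) (a : ℂ), IsTriangular T e l₁ l₂ a := by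
  have : FiniteDimensional ℂ V := Module.finite_of_finrank_pos (by omega)
  obtain ⟨y, hy⟩ := hns l₂
  -- The range of `T - l₂` is killed by `T - l₁`, so `w` is an eigenvector for `l₁`; this fixes the
  -- order of the diagonal.
  set w := T y - l₂ • y with hw
  have hw0 : w ≠ 0 := sub_ne_zero.mpr hy
  have hTw : T w = l₁ • w := by
    rw [← sub_eq_zero, ← hann y, hw]
    simp only [map_sub, map_smul]
    module
  set v : V := ((‖w‖⁻¹ : ℝ) : ℂ) • w with hv
  have hv1 : ‖v‖ = 1 := by
    rw [hv, norm_smul, Complex.norm_real, norm_inv, norm_norm]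
    exact inv_mul_cancel₀ (norm_ne_zero_iff.mpr hw0)
  have hTv : T v = l₁ • v := by rw [hv, map_smul, hTw, smul_comm]
  obtain ⟨e, he⟩ := Orthonormal.exists_orthonormalBasis_extension_of_card_eq (𝕜 := ℂ) (E := V)
    (ι := Fin 2) (by simpa using hV) (v := fun _ => v) (s := {0})
    ⟨fun _ => hv1, fun i j hij => (hij (Subsingleton.elim i j)).elim⟩
  have he0 : e 0 = v := he 0 rfl
  have hdec : ∀ x : V, x = ⟪e 0, x⟫_ℂ • e 0 + ⟪e 1, x⟫_ℂ • e 1 := fun x => by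
    simpa [Fin.sum_univ_two] using (e.sum_repr' x).symm
  have hT0 : T (e 0) = l₁ • e 0 := by rw [he0, hTv]
  obtain ⟨a, d, hT1⟩ : ∃ a d : ℂ, T (e 1) = a • e 0 + d • e 1 := ⟨_, _, hdec _⟩
  have key := hann (e 1)
  rw [hT1, map_add, map_smul, map_smul, hT0, hT1] at key
  have h0 := congrArg (fun x => ⟪e 0, x⟫_ℂ) key
  have h1 := congrArg (fun x => ⟪e 1, x⟫_ℂ) key
  simp only [inner_add_right, inner_sub_right, inner_smul_right, e.inner_eq_ite, inner_zero_right]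
    at h0 h1
  norm_num at h0 h1
  refine ⟨e, a, hT0, ?_⟩
  suffices d = l₂ by rw [hT1, this]
  -- The annihilating quadratic gives `(d - l₂)a = 0` and `(d - l₂)(d - l₁) = 0`. If `d ≠ l₂`, then
  -- `T` is the scalar `l₁`.
  by_contra hd
  have hd' : d - l₂ ≠ 0 := sub_ne_zero.mpr hd
  have ha : a = 0 := by
    refine (mul_eq_zero.mp (?_ : (d - l₂) * a = 0)).resolve_left hd'
    linear_combination h0
  have hd1 : d - l₁ = 0 := by
    refine (mul_eq_zero.mp (?_ : (d - l₂) * (d - l₁) = 0)).resolve_left hd'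
    linear_combination h1
  obtain ⟨x, hx⟩ := hns l₁
  refine hx ?_
  rw [hdec x, map_add, map_smul, map_smul, hT0, hT1, ha, sub_eq_zero.mp hd1]
  module

theorem IsTriangular.apply {T : V →L[ℂ] V} {e : OrthonormalBasis (Fin 2) ℂ V} {l₁ l₂ a : ℂ}
    (h : IsTriangular T e l₁ l₂ a) (p q : ℂ) :
    T (p • e 0 + q • e 1) = (l₁ * p + a * q) • e 0 + (l₂ * q) • e 1 := by
  rw [map_add, map_smul, map_smul, h.1, h.2]
  module

theorem norm_sq_comb (e : OrthonormalBasis (Fin 2) ℂ V) (p q : ℂ) :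
    ‖p • e 0 + q • e 1‖ ^ 2 = ‖p‖ ^ 2 + ‖q‖ ^ 2 := by
  rw [← e.sum_sq_norm_inner_right]
  simp [Fin.sum_univ_two, inner_add_right, inner_smul_right, e.inner_eq_ite]

theorem exists_comb (e : OrthonormalBasis (Fin 2) ℂ V) (x : V) :
    ∃ p q : ℂ, x = p • e 0 + q • e 1 :=
  ⟨_, _, by simpa [Fin.sum_univ_two] using (e.sum_repr' x).symm⟩

theorem norm_inner_le (e : OrthonormalBasis (Fin 2) ℂ V) (i : Fin 2) (x : V) :
    ‖⟪e i, x⟫_ℂ‖ ≤ ‖x‖ := by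
  simpa using norm_inner_le_norm (𝕜 := ℂ) (e i) x

/-- This is `det(1 - T*T) ≥ 0`, extracted by testing contractivity on one vector. The vector is
chosen so that the first coordinate of its image is exactly `a`. -/
theorem IsTriangular.corner_le {T : V →L[ℂ] V} {e : OrthonormalBasis (Fin 2) ℂ V} {l₁ l₂ a : ℂ}
    (h : IsTriangular T e l₁ l₂ a) (hT : ‖T‖ ≤ 1) (h1 : ‖l₁‖ < 1) :
    ‖a‖ ^ 2 ≤ (1 - ‖l₁‖ ^ 2) * (1 - ‖l₂‖ ^ 2) := by
  set m : ℝ := 1 - ‖l₁‖ ^ 2 with hm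
  have hm0 : 0 < m := by nlinarith [norm_nonneg l₁]
  have hc := T.le_of_opNorm_le hT ((conj l₁ * a) • e 0 + (m : ℂ) • e 1)
  rw [one_mul, h.apply] at hc
  have hc2 := pow_le_pow_left₀ (norm_nonneg _) hc 2
  rw [norm_sq_comb, norm_sq_comb] at hc2
  have h2 : l₁ * (conj l₁ * a) + a * (m : ℂ) = a := by
    rw [← mul_assoc, Complex.mul_conj, Complex.normSq_eq_norm_sq, hm]
    push_cast; ring
  rw [h2, norm_mul, norm_mul, RCLike.norm_conj, Complex.norm_real, Real.norm_of_nonneg hm0.le]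
    at hc2
  have h3 : m * ‖a‖ ^ 2 ≤ m * (m * (1 - ‖l₂‖ ^ 2)) := by
    rw [show ‖l₁‖ ^ 2 = 1 - m by rw [hm]; ring, mul_pow,
      mul_pow, show ‖l₁‖ ^ 2 = 1 - m by rw [hm]; ring] at *
    nlinarith
  exact le_of_mul_le_mul_left h3 hm0

/-- In coordinates `x = (p, q)`, norm preservation reads `m|p|² + |q|² = |p conj a + q conj l₂|²`
with `m = 1 - |l₁|²`. Cauchy–Schwarz weighted by `m` bounds the right side by `(|a|²/m +
|l₂|²)(m|p|² + |q|²)`, and the positive common factor cancels. -/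
theorem IsTriangular.le_corner [CompleteSpace V] {T : V →L[ℂ] V}
    {e : OrthonormalBasis (Fin 2) ℂ V} {l₁ l₂ a : ℂ}
    (h : IsTriangular T e l₁ l₂ a) (h1 : ‖l₁‖ < 1)
    {x : V} (hx : x ≠ 0) (hTx : ‖T.adjoint x‖ = ‖x‖) :
    (1 - ‖l₁‖ ^ 2) * (1 - ‖l₂‖ ^ 2) ≤ ‖a‖ ^ 2 := by
  have hadj := e.sum_sq_norm_inner_right (T.adjoint x)
  obtain ⟨p, q, rfl⟩ := exists_comb e x
  rw [hTx, norm_sq_comb, Fin.sum_univ_two, ContinuousLinearMap.adjoint_inner_right,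
    ContinuousLinearMap.adjoint_inner_right, h.1, h.2] at hadj
  simp only [inner_add_left, inner_add_right, inner_smul_left, inner_smul_right, e.inner_eq_ite]
    at hadj
  norm_num at hadj
  have hpq : 0 < ‖p‖ ^ 2 + ‖q‖ ^ 2 := by
    rw [← norm_sq_comb e]; positivity
  have htri : ‖p * conj a + q * conj l₂‖ ≤ ‖a‖ * ‖p‖ + ‖l₂‖ * ‖q‖ := by
    refine (norm_add_le _ _).trans_eq ?_
    simp [mul_comm]
  have htri2 := pow_le_pow_left₀ (norm_nonneg _) htri 2
  set m : ℝ := 1 - ‖l₁‖ ^ 2 with hm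
  have hm0 : 0 < m := by nlinarith [norm_nonneg l₁]
  set N : ℝ := m * ‖p‖ ^ 2 + ‖q‖ ^ 2 with hN
  have hN0 : 0 < N := by
    rcases (sq_nonneg ‖q‖).eq_or_lt with hq | hq
    · have : 0 < m * ‖p‖ ^ 2 := mul_pos hm0 (by linarith)
      linarith
    · have : 0 ≤ m * ‖p‖ ^ 2 := by positivity
      linarith
  have hNle : N ≤ (‖a‖ * ‖p‖ + ‖l₂‖ * ‖q‖) ^ 2 := by
    simp only [hN, hm]
    linarith
  have hcs : m * (‖a‖ * ‖p‖ + ‖l₂‖ * ‖q‖) ^ 2 ≤ (‖a‖ ^ 2 + m * ‖l₂‖ ^ 2) * N := by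
    -- This square is exactly the deficit in the weighted Cauchy–Schwarz inequality.
    have := sq_nonneg (‖a‖ * ‖q‖ - m * ‖l₂‖ * ‖p‖)
    simp only [hN]
    nlinarith
  have := mul_le_mul_of_nonneg_left hNle hm0.le
  have h3 : m * N ≤ (‖a‖ ^ 2 + m * ‖l₂‖ ^ 2) * N := this.trans hcs
  have h4 := le_of_mul_le_mul_right h3 hN0
  linarith

/-! ### Similarities between two triangular operators -/

variable {W : Type*} [NormedAddCommGroup W] [InnerProductSpace ℂ W]

/-- The operator with matrix `!![1, x; 0, y]` in the orthonormal bases `e` and `f`. -/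
def triangularMap (e : OrthonormalBasis (Fin 2) ℂ V) (f : OrthonormalBasis (Fin 2) ℂ W)
    (x y : ℂ) : V →L[ℂ] W :=
  (innerSL ℂ (e 0)).smulRight (f 0) + (innerSL ℂ (e 1)).smulRight (x • f 0 + y • f 1)

theorem triangularMap_comb (e : OrthonormalBasis (Fin 2) ℂ V) (f : OrthonormalBasis (Fin 2) ℂ W)
    (x y p q : ℂ) :
    triangularMap e f x y (p • e 0 + q • e 1) = (p + x * q) • f 0 + (y * q) • f 1 := by
  simp only [triangularMap, add_apply, ContinuousLinearMap.smulRight_apply, innerSL_apply_apply,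
    inner_add_right, inner_smul_right, e.inner_eq_ite]
  norm_num
  module

theorem norm_triangularMap_le (e : OrthonormalBasis (Fin 2) ℂ V)
    (f : OrthonormalBasis (Fin 2) ℂ W) (x y : ℂ) :
    ‖triangularMap e f x y‖ ≤ 1 + ‖x‖ + ‖y‖ := by
  refine (norm_add_le _ _).trans ?_
  rw [ContinuousLinearMap.norm_smulRight_apply, ContinuousLinearMap.norm_smulRight_apply,
    innerSL_apply_norm, innerSL_apply_norm, e.norm_eq_one, e.norm_eq_one, f.norm_eq_one]
  have := norm_add_le (x • f 0) (y • f 1)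
  rw [norm_smul, norm_smul, f.norm_eq_one, f.norm_eq_one] at this
  linarith

/-- The invertible operator with matrix `!![1, x; 0, y]` in the orthonormal bases `e` and `f`. -/
def triangularEquiv (e : OrthonormalBasis (Fin 2) ℂ V) (f : OrthonormalBasis (Fin 2) ℂ W)
    (x y : ℂ) (hy : y ≠ 0) : V ≃L[ℂ] W :=
  ContinuousLinearEquiv.equivOfInverse (triangularMap e f x y) (triangularMap f e (-(x / y)) y⁻¹)
    (fun v => by
      obtain ⟨p, q, rfl⟩ := exists_comb e v
      rw [triangularMap_comb, triangularMap_comb]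
      congr 2 <;> field_simp
      ring)
    (fun v => by
      obtain ⟨p, q, rfl⟩ := exists_comb f v
      rw [triangularMap_comb, triangularMap_comb]
      congr 2 <;> field_simp
      ring)

/-- With equal diagonals, only the corner entry of `XT = SX` is a condition: one equation `hxy` in
two unknowns. The freedom is used through the solutions `x = 0` and `y = 1`. -/
theorem triangularEquiv_intertwines {T : V →L[ℂ] V} {e : OrthonormalBasis (Fin 2) ℂ V}
    {S : W →L[ℂ] W} {f : OrthonormalBasis (Fin 2) ℂ W} {l₁ l₂ a s x y : ℂ}
    (hT : IsTriangular T e l₁ l₂ a) (hS : IsTriangular S f l₁ l₂ s) (hy : y ≠ 0)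
    (hxy : a = (l₁ - l₂) * x + s * y) (v : V) :
    triangularEquiv e f x y hy (T v) = S (triangularEquiv e f x y hy v) := by
  change triangularMap e f x y (T v) = S (triangularMap e f x y v)
  obtain ⟨p, q, rfl⟩ := exists_comb e v
  rw [hT.apply, triangularMap_comb, triangularMap_comb, hS.apply]
  congr 2
  · rw [hxy]; ring
  · ring

theorem exists_similarity {T : V →L[ℂ] V} {e : OrthonormalBasis (Fin 2) ℂ V}
    {S : W →L[ℂ] W} {f : OrthonormalBasis (Fin 2) ℂ W} {l₁ l₂ a s : ℂ}
    (hT : IsTriangular T e l₁ l₂ a) (hS : IsTriangular S f l₁ l₂ s) (hs : s ≠ 0)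
    (has : ‖a‖ ≤ ‖s‖) {K : ℝ} (hK : 0 ≤ K)
    (hsK : ‖S - l₂ • ContinuousLinearMap.id ℂ W‖ ≤ K * ‖T - l₂ • ContinuousLinearMap.id ℂ V‖) :
    ∃ X : V ≃L[ℂ] W, (∀ v, X (T v) = S (X v)) ∧
      max ‖(X : V →L[ℂ] W)‖ ‖(X.symm : W →L[ℂ] V)‖ ≤ 2 + 4 * K := by
  have hs0 : 0 < ‖s‖ := norm_pos_iff.mpr hs
  have hS1 : ‖s‖ ≤ ‖S - l₂ • ContinuousLinearMap.id ℂ W‖ := by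
    have := (S - l₂ • ContinuousLinearMap.id ℂ W).le_opNorm (f 1)
    simpa [hS.2, norm_smul] using this
  have hT1 : ‖T - l₂ • ContinuousLinearMap.id ℂ V‖ ≤ ‖l₁ - l₂‖ + ‖a‖ := by
    refine ContinuousLinearMap.opNorm_le_bound _ (by positivity) fun v => ?_
    -- Subtracting `l₂` empties the second row, leaving only the entries `l₁ - l₂` and `a`.
    have hv : (T - l₂ • ContinuousLinearMap.id ℂ V) v
        = ((l₁ - l₂) * ⟪e 0, v⟫_ℂ + a * ⟪e 1, v⟫_ℂ) • e 0 := by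
      have hdec : v = ⟪e 0, v⟫_ℂ • e 0 + ⟪e 1, v⟫_ℂ • e 1 := by
        simpa [Fin.sum_univ_two] using (e.sum_repr' v).symm
      generalize ⟪e 0, v⟫_ℂ = p at *
      generalize ⟪e 1, v⟫_ℂ = q at *
      subst hdec
      simp only [sub_apply, smul_apply, ContinuousLinearMap.id_apply, hT.apply]
      module
    rw [hv, norm_smul, e.norm_eq_one, mul_one, add_mul]
    refine (norm_add_le _ _).trans ?_
    rw [norm_mul, norm_mul]
    gcongr <;> exact norm_inner_le e _ v
  have hmain : ‖s‖ ≤ K * (‖l₁ - l₂‖ + ‖a‖) :=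
    (hS1.trans hsK).trans (mul_le_mul_of_nonneg_left hT1 hK)
  -- One of the two terms in `hmain` is at least half of `‖s‖`. A large `a` permits the diagonal
  -- similarity `x = 0`, `y = a / s`; a large `l₁ - l₂` permits the unipotent one with `y = 1`.
  rcases le_total (‖s‖) (2 * K * ‖a‖) with hA | hB
  · have ha : a ≠ 0 := by rintro rfl; simp at hA; exact hs hA
    have ha0 : 0 < ‖a‖ := norm_pos_iff.mpr ha
    refine ⟨triangularEquiv e f 0 (a / s) (div_ne_zero ha hs),
      triangularEquiv_intertwines hT hS _ (by field_simp; ring), max_le ?_ ?_⟩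
    · refine (norm_triangularMap_le e f _ _).trans ?_
      have : ‖a / s‖ ≤ 1 := by rw [norm_div]; exact div_le_one_of_le₀ has hs0.le
      rw [norm_zero]; linarith
    · refine (norm_triangularMap_le f e _ _).trans ?_
      have : ‖(a / s)⁻¹‖ ≤ 2 * K := by
        rw [inv_div, norm_div]; exact (div_le_iff₀ ha0).mpr hA
      rw [zero_div, neg_zero, norm_zero]; linarith
  · have hδ : ‖s‖ ≤ 2 * K * ‖l₁ - l₂‖ := by linarith
    have hd0 : 0 < ‖l₁ - l₂‖ := by
      refine (norm_nonneg _).lt_of_ne fun h => ?_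
      rw [← h, mul_zero] at hδ; linarith
    have hd : l₁ - l₂ ≠ 0 := norm_pos_iff.mp hd0
    -- `‖a - s‖ ≤ 2‖s‖` by `has`, and `hδ` supplies the other factor `2K`.
    have hx : ‖(a - s) / (l₁ - l₂)‖ ≤ 4 * K := by
      rw [norm_div, div_le_iff₀ hd0]
      have := norm_sub_le a s
      linarith
    refine ⟨triangularEquiv e f ((a - s) / (l₁ - l₂)) 1 one_ne_zero,
      triangularEquiv_intertwines hT hS _ (by field_simp; ring), max_le ?_ ?_⟩
    · refine (norm_triangularMap_le e f _ _).trans ?_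
      rw [norm_one]; linarith
    · refine (norm_triangularMap_le f e _ _).trans ?_
      rw [div_one, norm_neg, inv_one, norm_one]; linarith

end TwoDimensional

/-! ### Polynomials of degree one in the functional calculus -/

/-- The coordinate function `z` as an element of `H^∞`. -/
abbrev zInf : HInf := blaschke 0

theorem zInf_eval (z : 𝔻) : zInf.eval z = z := by
  simp [blaschke_eval]

theorem zInf_coeff (n : ℕ) : zInf.coeff n = if n = 1 then 1 else 0 := by
  have h : extZero zInf.1 =ᶠ[𝓝 0] fun z => z := by
    filter_upwards [Metric.ball_mem_nhds (0 : ℂ) one_pos] with z hz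
    rw [mem_ball_zero_iff] at hz
    rw [extZero_of_lt _ hz]
    exact zInf_eval _
  rw [HInf.coeff, h.iteratedDeriv_eq]
  rcases n with _ | n
  · simp
  · rw [iteratedDeriv_succ']
    simp only [deriv_id'', iteratedDeriv_const]
    by_cases hn : n = 0 <;> simp [hn]

theorem HInf.eval_add (u v : HInf) (z : 𝔻) : (u + v).eval z = u.eval z + v.eval z := rfl

theorem HInf.eval_mul (u v : HInf) (z : 𝔻) : (u * v).eval z = u.eval z * v.eval z := rfl

theorem HInf.eval_algebraMap (c : ℂ) (z : 𝔻) : (algebraMap ℂ HInf c).eval z = c := by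
  change (algebraMap ℂ (𝔻 →ᵇ ℂ) c) z = c
  simp [BoundedContinuousFunction.algebraMap_apply]

theorem HInf.ext_eval {u v : HInf} (h : ∀ z, u.eval z = v.eval z) : u = v :=
  Subtype.ext (BoundedContinuousFunction.ext h)

/-- The function `z - c` as an element of `H^∞`. -/
def linInf (c : ℂ) : HInf := zInf + algebraMap ℂ HInf (-c)

theorem linInf_eval (c : ℂ) (z : 𝔻) : (linInf c).eval z = z - c := by
  rw [linInf, HInf.eval_add, zInf_eval, HInf.eval_algebraMap, sub_eq_add_neg]

/-- The function `(1 - c z) (1 - d z)` as an element of `H^∞`. -/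
def denInf (c d : ℂ) : HInf :=
  (1 + algebraMap ℂ HInf (-c) * zInf) * (1 + algebraMap ℂ HInf (-d) * zInf)

theorem denInf_eval (c d : ℂ) (z : 𝔻) : (denInf c d).eval z = (1 - c * z) * (1 - d * z) := by
  have h1 : (1 : HInf).eval z = 1 := rfl
  simp only [denInf, HInf.eval_add, HInf.eval_mul, zInf_eval, HInf.eval_algebraMap, h1]
  ring

/-- Clearing the Blaschke denominators puts the quadratic polynomial with roots `l₁, l₂` in `θ H^∞`,
so it annihilates `T`. -/
theorem linInf_mul_linInf (l₁ l₂ : 𝔻) :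
    linInf l₁ * linInf l₂ = blaschke l₁ * blaschke l₂ * denInf (conj (l₁ : ℂ)) (conj (l₂ : ℂ)) := by
  refine HInf.ext_eval fun z => ?_
  simp only [HInf.eval_mul, linInf_eval, blaschke_eval, denInf_eval]
  have h1 := one_sub_ne_zero l₁ z
  have h2 := one_sub_ne_zero l₂ z
  generalize 1 - conj (l₁ : ℂ) * z = d₁ at *
  generalize 1 - conj (l₂ : ℂ) * z = d₂ at *
  field_simp

section Calculus

variable {H : Type*} [NormedAddCommGroup H] [InnerProductSpace ℂ H]

theorem hasValue_algebraMap [CompleteSpace H] (T : H →L[ℂ] H) (c : ℂ) :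
    HasValue T (algebraMap ℂ HInf c) (algebraMap ℂ (H →L[ℂ] H) c) := fun x => by
  simp only [dilate_algebraMap]
  exact tendsto_const_nhds

theorem hasValue_zInf (T : H →L[ℂ] H) : HasValue T zInf T := fun x => by
  have h : ∀ r : ℝ, dilate T zInf r = (r : ℂ) • T := fun r => by
    rw [dilate, tsum_eq_single 1 fun n hn => by simp [zInf_coeff, hn]]
    simp [zInf_coeff]
  simp only [h]
  have hr : Tendsto (fun r : ℝ => (r : ℂ)) (𝓝[<] 1) (𝓝 ((1 : ℝ) : ℂ)) :=
    (Complex.continuous_ofReal.tendsto 1).mono_left nhdsWithin_le_nhds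
  simpa using hr.smul_const (T x)

theorem hasValue_linInf {T : H →L[ℂ] H} [CompleteSpace H] (hT : ‖T‖ ≤ 1) (c : ℂ) :
    HasValue T (linInf c) (T - c • ContinuousLinearMap.id ℂ H) := by
  have h := (hasValue_zInf T).add hT (hasValue_algebraMap T (-c))
  have h2 : T + algebraMap ℂ (H →L[ℂ] H) (-c) = T - c • ContinuousLinearMap.id ℂ H := by
    rw [Algebra.algebraMap_eq_smul_one, neg_smul, sub_eq_add_neg]; rfl
  rwa [h2] at h

theorem HasValue.unique {T : H →L[ℂ] H} {u : HInf} {A B : H →L[ℂ] H} (hA : HasValue T u A)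
    (hB : HasValue T u B) : A = B :=
  ContinuousLinearMap.ext fun x => tendsto_nhds_unique (hA x) (hB x)

/-- A degree count that keeps `T` from being scalar. Evaluating at the two roots forces `c = l₁ =
l₂`; cancelling `z - l₁` then leaves `(1 - conj l₁ z)² = (z - l₁) f(z)`, impossible as `z → l₁`
because `f` is bounded. -/
theorem linInf_ne_blaschke_mul (l₁ l₂ : 𝔻) (c : ℂ) (f : HInf) :
    linInf c ≠ blaschke l₁ * blaschke l₂ * f := by
  intro h
  have hev : ∀ z : 𝔻, (z : ℂ) - c =
      ((z : ℂ) - l₁) / (1 - conj (l₁ : ℂ) * z) * (((z : ℂ) - l₂) / (1 - conj (l₂ : ℂ) * z))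
        * f.eval z := fun z => by
    rw [← linInf_eval, h]; rfl
  have h1 := hev l₁
  have h2 := hev l₂
  simp only [sub_self, zero_div, zero_mul, mul_zero] at h1 h2
  have hl : (l₂ : ℂ) = l₁ := by linear_combination h2 - h1
  have hc : c = l₁ := by linear_combination -h1
  have hbd : ∀ᶠ z in 𝓝[≠] (l₁ : ℂ), ‖1 - conj (l₁ : ℂ) * z‖ ^ 2 ≤ ‖z - l₁‖ * ‖f.1‖ := by
    have hball : Metric.ball (0 : ℂ) 1 ∈ 𝓝 (l₁ : ℂ) :=
      Metric.isOpen_ball.mem_nhds (by simpa using l₁.norm_lt_one)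
    filter_upwards [self_mem_nhdsWithin, mem_nhdsWithin_of_mem_nhds hball] with z hz1 hz2
    rw [mem_ball_zero_iff] at hz2
    have hz := hev (Complex.UnitDisc.mk z hz2)
    rw [Complex.UnitDisc.coe_mk, hl, hc] at hz
    have hne : z - l₁ ≠ 0 := sub_ne_zero.mpr hz1
    have hden := one_sub_ne_zero l₁ (Complex.UnitDisc.mk z hz2)
    rw [Complex.UnitDisc.coe_mk] at hden
    have h3 : (1 - conj (l₁ : ℂ) * z) ^ 2 = (z - l₁) * f.eval (Complex.UnitDisc.mk z hz2) := by
      generalize 1 - conj (l₁ : ℂ) * z = d at *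
      field_simp at hz
      linear_combination hz
    rw [← norm_pow, h3, norm_mul]
    exact mul_le_mul_of_nonneg_left (f.1.norm_coe_le_norm _) (norm_nonneg _)
  have hlim1 : Tendsto (fun z : ℂ => ‖1 - conj (l₁ : ℂ) * z‖ ^ 2) (𝓝[≠] (l₁ : ℂ))
      (𝓝 (‖1 - conj (l₁ : ℂ) * l₁‖ ^ 2)) :=
    (Continuous.tendsto (by fun_prop) _).mono_left nhdsWithin_le_nhds
  have hlim2 : Tendsto (fun z : ℂ => ‖z - l₁‖ * ‖f.1‖) (𝓝[≠] (l₁ : ℂ))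
      (𝓝 (‖(l₁ : ℂ) - l₁‖ * ‖f.1‖)) :=
    (Continuous.tendsto (by fun_prop) _).mono_left nhdsWithin_le_nhds
  have hle := le_of_tendsto_of_tendsto hlim1 hlim2 hbd
  rw [sub_self, norm_zero, zero_mul] at hle
  have := norm_pos_iff.mpr (one_sub_ne_zero l₁ l₁)
  nlinarith

variable [CompleteSpace H]

/-- The quadratic relation confines the orbit of a cyclic vector `x` to the span of `x` and `T x`.
That span is finite-dimensional, hence closed, hence everything; it has dimension exactly two
because `T` is not scalar. -/
theorem exists_isTriangular_of_isMinimalFunction {T : H →L[ℂ] H} (hT : ‖T‖ ≤ 1)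
    (hcyc : MultiplicityFree T) {l₁ l₂ : 𝔻}
    (hmin : IsMinimalFunction T (blaschke l₁ * blaschke l₂)) :
    ∃ (e : OrthonormalBasis (Fin 2) ℂ H) (a : ℂ), IsTriangular T e l₁ l₂ a := by
  have hmul : ∀ x, T (T x) - ((l₁ : ℂ) + l₂) • T x + ((l₁ : ℂ) * l₂) • x = 0 := fun x => by
    have h0 := (hmin.2 _).mpr ⟨_, linInf_mul_linInf l₁ l₂⟩
    have h1 := ((hasValue_linInf hT l₁).mul hT (hasValue_linInf hT l₂)).unique h0
    have h2 := DFunLike.congr_fun h1 x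
    simp only [mul_apply_eq_comp, sub_apply, smul_apply,
      ContinuousLinearMap.id_apply, map_sub, map_smul, zero_apply] at h2
    rw [← h2]
    module
  have hns : ∀ μ : ℂ, ∃ x, T x ≠ μ • x := by
    intro μ
    by_contra! hμ
    have h0 : T - μ • ContinuousLinearMap.id ℂ H = 0 := by
      ext x; simp [hμ]
    have h1 := hasValue_linInf hT μ
    rw [h0] at h1
    obtain ⟨f, hf⟩ := (hmin.2 _).mp h1
    exact linInf_ne_blaschke_mul l₁ l₂ μ f hf
  obtain ⟨x, hx⟩ := hcyc
  have hinv : ∀ n : ℕ, (T ^ n) x ∈ Submodule.span ℂ {x, T x} := by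
    intro n
    induction n with
    | zero => exact Submodule.subset_span (by simp)
    | succ n ih =>
      rw [pow_succ', mul_apply_eq_comp]
      obtain ⟨p, q, hpq⟩ := Submodule.mem_span_pair.mp ih
      refine Submodule.mem_span_pair.mpr ⟨-(l₁ * l₂ * q), p + (l₁ + l₂) * q, ?_⟩
      rw [← hpq, map_add, map_smul, map_smul, ← sub_eq_zero, ← neg_eq_zero,
        ← smul_zero q, ← hmul x]
      module
  have hspan : Submodule.span ℂ {x, T x} = ⊤ := by
    have : FiniteDimensional ℂ (Submodule.span ℂ ({x, T x} : Set H)) :=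
      FiniteDimensional.span_of_finite ℂ (by simp)
    rw [eq_top_iff, ← hx]
    refine Submodule.topologicalClosure_minimal _ (Submodule.span_le.mpr ?_)
      (Submodule.closed_of_finiteDimensional _)
    rintro _ ⟨n, rfl⟩
    exact hinv n
  have hdec : ∀ y : H, ∃ p q : ℂ, p • x + q • T x = y := fun y =>
    Submodule.mem_span_pair.mp (hspan ▸ Submodule.mem_top)
  -- An eigenvector `x` that generates the space would make `T` scalar, and `x = 0` would make the
  -- space trivial.
  have hli : LinearIndependent ℂ ![x, T x] := by
    rw [LinearIndependent.pair_iff' fun h0 => ?_]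
    · intro μ hμ
      obtain ⟨y, hy⟩ := hns μ
      obtain ⟨p, q, rfl⟩ := hdec y
      refine hy ?_
      simp only [map_add, map_smul, ← hμ]
      module
    · obtain ⟨y, hy⟩ := hns 0
      obtain ⟨p, q, rfl⟩ := hdec y
      simp [h0] at hy
  have hrank : Module.finrank ℂ H = 2 := by
    have := Module.finrank_eq_card_basis (Module.Basis.mk hli (by
      rw [Matrix.range_cons, Matrix.range_cons, Matrix.range_empty, Set.union_empty]
      exact hspan.ge))
    simpa using this
  exact exists_isTriangular hrank T l₁ l₂ hmul hns

end Calculus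

/-! ### The model space of a product of two Blaschke factors -/

section ModelSpace

theorem HTwo.add_apply (f g : HTwo) (n : ℕ) : (f + g) n = f n + g n := rfl

theorem HTwo.sub_apply (f g : HTwo) (n : ℕ) : (f - g) n = f n - g n := rfl

theorem HTwo.smul_apply (c : ℂ) (f : HTwo) (n : ℕ) : (c • f) n = c * f n := rfl

theorem HTwo.zero_apply (n : ℕ) : (0 : HTwo) n = 0 := rfl

theorem HTwo.eval_sub (f g : HTwo) (z : 𝔻) : (f - g).eval z = f.eval z - g.eval z := by
  have h := HTwo.eval_add (f - g) g z
  rw [sub_add_cancel] at h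
  exact eq_sub_of_add_eq h.symm

theorem HTwo.ext_eval {f g : HTwo} (h : ∀ z, f.eval z = g.eval z) : f = g := by
  set d : HTwo := f - g with hd
  have hd0 : ∀ z, d.eval z = 0 := fun z => by rw [hd, HTwo.eval_sub, h, sub_self]
  have hp : HasFPowerSeriesAt (fun _ : ℂ => (0 : ℂ))
      (FormalMultilinearSeries.ofScalars ℂ (fun n => d n)) 0 := by
    rw [hasFPowerSeriesAt_iff]
    filter_upwards [Metric.ball_mem_nhds (0 : ℂ) one_pos] with z hz
    rw [mem_ball_zero_iff] at hz
    have hs := (d.summable (Complex.UnitDisc.mk z hz)).hasSum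
    change HasSum _ (d.eval _) at hs
    rw [hd0] at hs
    refine hs.congr_fun fun n => ?_
    simp [FormalMultilinearSeries.coeff_ofScalars, mul_comm]
  have hz := FormalMultilinearSeries.ofScalars_series_eq_zero ℂ |>.mp hp.eq_zero
  rw [← sub_eq_zero, ← hd]
  ext n
  exact congrFun hz n

/-- The backward shift `S*`. -/
abbrev backShift : HTwo →L[ℂ] HTwo := shift.toContinuousLinearMap.adjoint

theorem inner_backShift_left (f g : HTwo) : ⟪backShift f, g⟫_ℂ = ⟪f, shift g⟫_ℂ :=
  ContinuousLinearMap.adjoint_inner_left _ _ _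

theorem inner_backShift_right (f g : HTwo) : ⟪f, backShift g⟫_ℂ = ⟪shift f, g⟫_ℂ :=
  ContinuousLinearMap.adjoint_inner_right _ _ _

theorem backShift_shift (f : HTwo) : backShift (shift f) = f :=
  ext_inner_right ℂ fun g => by rw [inner_backShift_left, LinearIsometry.inner_map_map]

theorem shift_zero (f : HTwo) : shift f 0 = 0 := rfl

theorem shift_succ (f : HTwo) (n : ℕ) : shift f (n + 1) = f n := rfl

theorem shift_single (n : ℕ) (c : ℂ) :
    shift (lp.single 2 n c) = (lp.single 2 (n + 1) c : HTwo) := by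
  ext m
  cases m with
  | zero => simp [shift_zero, lp.single_apply]
  | succ m => simp [shift_succ, lp.single_apply, Pi.single_apply]

theorem backShift_apply (f : HTwo) (n : ℕ) : backShift f n = f (n + 1) := by
  have h1 := lp.inner_single_left (𝕜 := ℂ) n (1 : ℂ) (backShift f)
  have h2 := lp.inner_single_left (𝕜 := ℂ) (n + 1) (1 : ℂ) f
  rw [inner_backShift_right, shift_single, h2] at h1
  simpa using h1.symm

/-- Division by `1 - c z` inside `H²`: since `‖cS‖ < 1`, the operator `1 - cS` is invertible. -/
theorem exists_resolvent {c : ℂ} (hc : ‖c‖ < 1) (y : HTwo) : ∃ x : HTwo, x = y + c • shift x := by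
  set R : HTwo →L[ℂ] HTwo := c • shift.toContinuousLinearMap with hR
  have hR1 : ‖R‖ < 1 := by
    rw [hR, norm_smul]
    refine lt_of_le_of_lt ?_ hc
    exact mul_le_of_le_one_right (norm_nonneg _) shift.norm_toContinuousLinearMap_le
  set U := Units.oneSub R hR1
  refine ⟨(U⁻¹ : (HTwo →L[ℂ] HTwo)ˣ).1 y, ?_⟩
  have h := DFunLike.congr_fun U.mul_inv y
  have h2 : (U⁻¹ : (HTwo →L[ℂ] HTwo)ˣ).1 y - c • shift ((U⁻¹ : (HTwo →L[ℂ] HTwo)ˣ).1 y) = y := h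
  exact eq_add_of_sub_eq h2

/-! ### The model space as the kernel of a quadratic in the backward shift -/

variable (l₁ l₂ : 𝔻)

/-- The denominators of the Blaschke factors act invertibly on `H²`, so `θH²` is the range of the
polynomial `(S - l₁)(S - l₂)`. -/
theorem mem_mulRange_iff (f : HTwo) :
    f ∈ mulRange (blaschke l₁ * blaschke l₂) ↔
      ∃ g : HTwo, f = shift (shift g) - ((l₁ : ℂ) + l₂) • shift g + ((l₁ : ℂ) * l₂) • g := by
  constructor
  · rintro ⟨g, hg⟩
    obtain ⟨g₁, h₁⟩ := exists_resolvent (c := conj (l₁ : ℂ))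
      (by rw [RCLike.norm_conj]; exact l₁.norm_lt_one) g
    obtain ⟨g₂, h₂⟩ := exists_resolvent (c := conj (l₂ : ℂ))
      (by rw [RCLike.norm_conj]; exact l₂.norm_lt_one) g₁
    refine ⟨g₂, HTwo.ext_eval fun z => ?_⟩
    have e₁ := congrArg (fun x : HTwo => x.eval z) h₁
    have e₂ := congrArg (fun x : HTwo => x.eval z) h₂
    simp only [HTwo.eval_add, HTwo.eval_smul, eval_shift] at e₁ e₂
    have n₁ := one_sub_ne_zero l₁ z
    have n₂ := one_sub_ne_zero l₂ z
    have hg₁ : g₁.eval z = (1 - conj (l₂ : ℂ) * z) * g₂.eval z := by linear_combination -e₂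
    have hg₀ : g.eval z = (1 - conj (l₁ : ℂ) * z) * g₁.eval z := by linear_combination -e₁
    simp only [HTwo.eval_add, HTwo.eval_sub, HTwo.eval_smul, eval_shift]
    rw [hg, HInf.eval_mul, blaschke_eval, blaschke_eval, hg₀, hg₁]
    generalize 1 - conj (l₁ : ℂ) * z = d₁ at *
    generalize 1 - conj (l₂ : ℂ) * z = d₂ at *
    field_simp
    ring
  · rintro ⟨g, rfl⟩
    -- The witness is `(1 - conj l₁ z)(1 - conj l₂ z) g`, expanded.
    refine ⟨g - (conj (l₁ : ℂ) + conj (l₂ : ℂ)) • shift g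
      + (conj (l₁ : ℂ) * conj (l₂ : ℂ)) • shift (shift g), fun z => ?_⟩
    have n₁ := one_sub_ne_zero l₁ z
    have n₂ := one_sub_ne_zero l₂ z
    simp only [HTwo.eval_add, HTwo.eval_sub, HTwo.eval_smul, eval_shift]
    rw [HInf.eval_mul, blaschke_eval, blaschke_eval]
    trans ((z : ℂ) - l₁) / (1 - conj (l₁ : ℂ) * z) * (((z : ℂ) - l₂) / (1 - conj (l₂ : ℂ) * z))
      * ((1 - conj (l₁ : ℂ) * z) * (1 - conj (l₂ : ℂ) * z) * g.eval z)
    · generalize 1 - conj (l₁ : ℂ) * z = d₁ at *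
      generalize 1 - conj (l₂ : ℂ) * z = d₂ at *
      field_simp
      ring
    · ring

/-- The orthogonal complement of a range is the kernel of the adjoint, here `(S* - conj l₁)(S* -
conj l₂)`. -/
theorem mem_HTheta_iff (f : HTwo) :
    f ∈ HTheta (blaschke l₁ * blaschke l₂) ↔
      backShift (backShift f) - (conj (l₁ : ℂ) + conj (l₂ : ℂ)) • backShift f
        + (conj (l₁ : ℂ) * conj (l₂ : ℂ)) • f = 0 := by
  have key : ∀ g : HTwo,
      ⟪shift (shift g) - ((l₁ : ℂ) + l₂) • shift g + ((l₁ : ℂ) * l₂) • g, f⟫_ℂ =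
      ⟪g, backShift (backShift f) - (conj (l₁ : ℂ) + conj (l₂ : ℂ)) • backShift f
        + (conj (l₁ : ℂ) * conj (l₂ : ℂ)) • f⟫_ℂ := fun g => by
    simp only [inner_add_left, inner_sub_left, inner_smul_left, inner_add_right, inner_sub_right,
      inner_smul_right, inner_backShift_right, map_add, map_mul]
  rw [Submodule.mem_orthogonal]
  constructor
  · intro h
    refine ext_inner_left ℂ fun g => ?_
    rw [← key, inner_zero_right]
    exact h _ ((mem_mulRange_iff l₁ l₂ _).mpr ⟨g, rfl⟩)
  · intro h u hu
    obtain ⟨g, rfl⟩ := (mem_mulRange_iff l₁ l₂ u).mp hu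
    rw [key, h, inner_zero_right]

theorem adjoint_jordanBlock_coe (θ : HInf) (x : HTheta θ) :
    (((jordanBlock θ).adjoint x : HTheta θ) : HTwo) = backShift x := by
  rw [jordanBlock, ContinuousLinearMap.adjoint_adjoint]
  rfl

/-- The model space of `b_{l₁} b_{l₂}` has a basis `v₁, v₂` with `S* v₁ = \bar l₁ v₁` and
`S* v₂ = v₁ + \bar l₂ v₂`, in which `v₂` vanishes at the origin. -/
theorem exists_HTheta_vectors :
    ∃ v₁ v₂ : HTwo, v₁ ∈ HTheta (blaschke l₁ * blaschke l₂) ∧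
      v₂ ∈ HTheta (blaschke l₁ * blaschke l₂) ∧ v₁ 0 = 1 ∧ v₂ 0 = 0 ∧ v₂ 1 = 1 ∧
      backShift v₂ = v₁ + conj (l₂ : ℂ) • v₂ ∧ ‖backShift v₂‖ = ‖v₂‖ := by
  -- Here `k = 1/(1 - conj l₁ z)` is the Szegő kernel and `w = k/(1 - conj l₂ z)`. Taking `v₁ = k`
  -- and `v₂ = S w` also works when `l₁ = l₂`, and `S* v₂ = w` has the norm of `v₂` because `S` is
  -- isometric.
  obtain ⟨k, hk⟩ := exists_resolvent (c := conj (l₁ : ℂ))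
    (by rw [RCLike.norm_conj]; exact l₁.norm_lt_one) (lp.single 2 0 1)
  obtain ⟨w, hw⟩ := exists_resolvent (c := conj (l₂ : ℂ))
    (by rw [RCLike.norm_conj]; exact l₂.norm_lt_one) k
  have hk0 : k 0 = 1 := by
    rw [hk, HTwo.add_apply, HTwo.smul_apply, shift_zero]; simp [lp.single_apply]
  have hw0 : w 0 = 1 := by
    rw [hw, HTwo.add_apply, HTwo.smul_apply, shift_zero, hk0]; simp
  have he : backShift (lp.single 2 0 1 : HTwo) = 0 := by
    ext n
    rw [backShift_apply]
    simp [lp.single_apply]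
  have hBk : backShift k = conj (l₁ : ℂ) • k := by
    conv_lhs => rw [hk, map_add, he, map_smul, backShift_shift, zero_add]
  have hBw : backShift (shift w) = k + conj (l₂ : ℂ) • shift w := by
    rw [backShift_shift]; exact hw
  refine ⟨k, shift w, ?_, ?_, hk0, shift_zero w, by rw [← hw0]; rfl, hBw, ?_⟩
  · rw [mem_HTheta_iff, hBk, map_smul, hBk]
    module
  · rw [mem_HTheta_iff, hBw, map_add, map_smul, hBk, hBw]
    module
  · rw [backShift_shift, shift.norm_map]

/-- Coefficients of functions in `H(θ)` obey a second-order recurrence, so the first two determine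
the rest and the dimension is at most two; `v₁` and `v₂` show it is two. The corner is large because
`S(θ)*` preserves the norm of `v₂`. -/
theorem exists_isTriangular_jordanBlock :
    ∃ (f : OrthonormalBasis (Fin 2) ℂ (HTheta (blaschke l₁ * blaschke l₂))) (s : ℂ),
      IsTriangular (jordanBlock (blaschke l₁ * blaschke l₂)) f l₁ l₂ s ∧
      (1 - ‖(l₁ : ℂ)‖ ^ 2) * (1 - ‖(l₂ : ℂ)‖ ^ 2) ≤ ‖s‖ ^ 2 := by
  obtain ⟨v₁, v₂, m₁, m₂, h10, h20, h21, hB, hnorm⟩ := exists_HTheta_vectors l₁ l₂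
  set θ := blaschke l₁ * blaschke l₂ with hθ
  let φ : HTheta θ →ₗ[ℂ] (Fin 2 → ℂ) :=
    { toFun := fun x => ![(x : HTwo) 0, (x : HTwo) 1]
      map_add' := fun x y => by ext i; fin_cases i <;> rfl
      map_smul' := fun c x => by ext i; fin_cases i <;> rfl }
  have hφ : Function.Injective φ := by
    rw [← LinearMap.ker_eq_bot, LinearMap.ker_eq_bot']
    intro x hx
    have x0 : (x : HTwo) 0 = 0 := congrFun hx 0
    have x1 : (x : HTwo) 1 = 0 := congrFun hx 1
    have hrec := (mem_HTheta_iff l₁ l₂ _).mp x.2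
    have hall : ∀ n, (x : HTwo) n = 0 ∧ (x : HTwo) (n + 1) = 0 := by
      intro n
      induction n with
      | zero => exact ⟨x0, x1⟩
      | succ n ih =>
        refine ⟨ih.2, ?_⟩
        have h := congrArg (fun f : HTwo => f n) hrec
        simpa only [HTwo.add_apply, HTwo.sub_apply, HTwo.smul_apply, HTwo.zero_apply,
          backShift_apply, ih.1, ih.2, mul_zero, sub_zero, add_zero] using h
    ext n
    exact (hall n).1
  have hfin : FiniteDimensional ℂ (HTheta θ) := FiniteDimensional.of_injective φ hφ
  have hli : LinearIndependent ℂ ![(⟨v₁, m₁⟩ : HTheta θ), ⟨v₂, m₂⟩] := by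
    rw [LinearIndependent.pair_iff]
    intro s t hst
    have h := congrArg (fun x : HTheta θ => φ x) hst
    have h0 := congrFun h 0
    have h1 := congrFun h 1
    simp only [map_add, map_smul, map_zero] at h0 h1
    simp [φ, h10, h20, h21] at h0 h1
    rw [h0, zero_mul, zero_add] at h1
    exact ⟨h0, h1⟩
  have hrank : Module.finrank ℂ (HTheta θ) = 2 := by
    have h1 := LinearMap.finrank_le_finrank_of_injective hφ
    have h2 := hli.fintype_card_le_finrank
    simp at h1 h2
    omega
  have hann : ∀ x, jordanBlock θ (jordanBlock θ x) - ((l₁ : ℂ) + l₂) • jordanBlock θ x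
      + ((l₁ : ℂ) * l₂) • x = 0 := fun x => by
    refine ext_inner_right ℂ fun y => ?_
    have hy := (mem_HTheta_iff l₁ l₂ _).mp y.2
    have hy' : (jordanBlock θ).adjoint ((jordanBlock θ).adjoint y)
        - (conj (l₁ : ℂ) + conj (l₂ : ℂ)) • (jordanBlock θ).adjoint y
        + (conj (l₁ : ℂ) * conj (l₂ : ℂ)) • y = 0 := by
      apply Subtype.ext
      simpa [adjoint_jordanBlock_coe] using hy
    have h := congrArg (fun z => ⟪x, z⟫_ℂ) hy'
    simp only [inner_add_right, inner_sub_right, inner_smul_right,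
      ContinuousLinearMap.adjoint_inner_right, inner_zero_right] at h
    simpa only [inner_add_left, inner_sub_left, inner_smul_left, map_add, map_mul,
      inner_zero_left] using h
  have hns : ∀ μ : ℂ, ∃ x, jordanBlock θ x ≠ μ • x := by
    intro μ
    by_contra! hμ
    -- A scalar adjoint would contradict values at the origin: `v₂` vanishes there while `S* v₂`
    -- equals `1`.
    have h1 : (jordanBlock θ).adjoint ⟨v₂, m₂⟩ = conj μ • ⟨v₂, m₂⟩ :=
      ext_inner_left ℂ fun x => by
        rw [ContinuousLinearMap.adjoint_inner_right, hμ, inner_smul_left, inner_smul_right]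
    have h2 := congrArg (fun x : HTheta θ => (x : HTwo) 0) h1
    simp only [adjoint_jordanBlock_coe, hB] at h2
    simp [HTwo.add_apply, HTwo.smul_apply, -lp.coeFn_add, -lp.coeFn_smul, h10, h20] at h2
  obtain ⟨f, s, hf⟩ := exists_isTriangular hrank (jordanBlock θ) l₁ l₂ hann hns
  refine ⟨f, s, hf, hf.le_corner l₁.norm_lt_one (x := ⟨v₂, m₂⟩) ?_ ?_⟩
  · intro h
    have h2 : v₂ = 0 := congrArg Subtype.val h
    rw [h2] at h21
    simp at h21
  · change ‖(((jordanBlock θ).adjoint ⟨v₂, m₂⟩ : HTheta θ) : HTwo)‖ = ‖v₂‖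
    rw [adjoint_jordanBlock_coe]
    exact hnorm

/-- If `‖S(θ) - l₂‖ ≤ K ‖T - l₂‖`, then `T` is similar to `S(θ)` with constant `2 + 4 K`. -/
theorem exists_similarity_jordanBlock {H : Type*} [NormedAddCommGroup H] [InnerProductSpace ℂ H]
    [CompleteSpace H] {T : H →L[ℂ] H} (hT : ‖T‖ ≤ 1) (hcyc : MultiplicityFree T)
    (hmin : IsMinimalFunction T (blaschke l₁ * blaschke l₂)) {K : ℝ} (hK : 0 ≤ K)
    (hle : ‖jordanBlock (blaschke l₁ * blaschke l₂) - (l₂ : ℂ) • ContinuousLinearMap.id ℂ _‖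
      ≤ K * ‖T - (l₂ : ℂ) • ContinuousLinearMap.id ℂ H‖) :
    ∃ X : H ≃L[ℂ] HTheta (blaschke l₁ * blaschke l₂),
      (∀ h, X (T h) = jordanBlock (blaschke l₁ * blaschke l₂) (X h)) ∧
      max ‖(X : H →L[ℂ] HTheta (blaschke l₁ * blaschke l₂))‖
        ‖(X.symm : HTheta (blaschke l₁ * blaschke l₂) →L[ℂ] H)‖ ≤ 2 + 4 * K := by
  obtain ⟨e, a, he⟩ := exists_isTriangular_of_isMinimalFunction hT hcyc hmin
  obtain ⟨f, s, hf, hs⟩ := exists_isTriangular_jordanBlock l₁ l₂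
  have ha := he.corner_le hT l₁.norm_lt_one
  have hpos : 0 < (1 - ‖(l₁ : ℂ)‖ ^ 2) * (1 - ‖(l₂ : ℂ)‖ ^ 2) :=
    mul_pos (by nlinarith [l₁.norm_lt_one, norm_nonneg (l₁ : ℂ)])
      (by nlinarith [l₂.norm_lt_one, norm_nonneg (l₂ : ℂ)])
  have hs0 : s ≠ 0 := by
    rintro rfl
    simp only [norm_zero] at hs
    nlinarith
  exact exists_similarity he hf hs0 (le_of_sq_le_sq (ha.trans hs) (norm_nonneg _)) hK hle

end ModelSpace

end C0Similarity

end

open C0Similarity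
/-- There is a function `C`, independent of the operator, of the space and of the roots, such that
the similarity `X` between `T` and `S(θ)` is controlled by `C(‖Ψ‖)`. -/
theorem corollary3p8 :
    ∃ C : ℝ → ℝ, (∀ t, 0 < C t) ∧
      ∀ (H : Type*) [NormedAddCommGroup H] [InnerProductSpace ℂ H] [CompleteSpace H]
        (T : H →L[ℂ] H) (hT : IsClassC0 T) (_ : MultiplicityFree T)
        (l₁ l₂ : 𝔻) (θ : HInf)
        (_ : θ = blaschke l₁ * blaschke l₂)
        (_ : IsMinimalFunction T θ)
        (Ψ : HInfOf T hT.contraction →L[ℂ]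
          HInfOf (jordanBlock θ) (norm_jordanBlock_le θ))
        (_ : ∀ (u : HInf) (A : HInfOf T hT.contraction)
          (B : HInfOf (jordanBlock θ)
            (norm_jordanBlock_le θ)),
          HasValue T u A → HasValue (jordanBlock θ) u B →
            Ψ A = B),
        ∃ X : H ≃L[ℂ] HTheta θ,
          (∀ h : H, X (T h) = jordanBlock θ (X h)) ∧
          max ‖(X : H →L[ℂ] HTheta θ)‖
            ‖(X.symm : HTheta θ →L[ℂ] H)‖ ≤ C ‖Ψ‖ := by
  -- The absolute value only secures positivity at negative arguments.
  refine ⟨fun t => 2 + 4 * |t|, fun t => by positivity, ?_⟩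
  intro H _ _ _ T hT hcyc l₁ l₂ θ hθ hmin Ψ hΨ
  subst hθ
  have hA := hasValue_linInf hT.contraction (l₂ : ℂ)
  have hB := hasValue_linInf (norm_jordanBlock_le (blaschke l₁ * blaschke l₂)) (l₂ : ℂ)
  -- Boundedness of `Ψ` is needed at the one element `T - l₂`, whose image is `S(θ) - l₂`.
  have hle := Ψ.le_opNorm ⟨_, _, hA⟩
  rw [hΨ _ ⟨_, _, hA⟩ ⟨_, _, hB⟩ hA hB] at hle
  obtain ⟨X, hX, hX2⟩ := exists_similarity_jordanBlock l₁ l₂ hT.contraction hcyc hmin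
    (norm_nonneg Ψ) hle
  exact ⟨X, hX, hX2.trans (by linarith only [le_abs_self ‖Ψ‖])⟩
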